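/- Let $p$ be a prime, let $\Bbbk$ be a commutative ring of characteristic $p$, and let $m = 2p^r$ with $r \ge 0$. Let $\mathrm{TL}_{m-1}(0)$ be the Temperley–Lieb algebra over $\Bbbk$ on $m-1$ strands in which a closed loop has value $0$; its basis consists of the TL diagrams, i.e. the crossingless perfect matchings of $m-1$ points on the top and $m-1$ points on the bottom of a planar strip. Let $\mathrm{JW} \in \mathrm{TL}_{m-1}(0)$ be the Jones–Wenzl projector, i.e. the element in which the identity diagram has coefficient $1$ and with $U_i\,\mathrm{JW} = \mathrm{JW}\,U_i = 0$ for all $1 \le i \le m-2$, where $U_i$ is the diagram with a cup on top and a cap on the bottom joining the points $i, i+1$ and vertical strands elsewhere. Number the points of each row by $1, \dots, m-1$ from left to right, and call a cap (a strand joining two bottom points) or a cup (a strand joining two top points) even or odd according to the parity of its left endpoint. Let $A$ be an abelian group and $f_s, g_s, f_t, g_t \in A$. In the two-color diagrammatics of the Hecke category, with startdots, enddots, splits and merges of color $c \in \{s,t\}$ of degrees $f_c, g_c, -g_c, -f_c$, and with the regions of a TL diagram colored alternately (the leftmost one by $s$), the deformation retract gives an even cap the degree $g_s - f_t$, an odd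 cap $g_t - f_s$, an even cup $f_s - g_t$ and an odd cup $f_t - g_s$. Let the degree of a TL diagram be the sum of the degrees of its cups and caps, that is, $$\deg(D) = (\#\{\text{even caps}\} - \#\{\text{odd cups}\})(g_s - f_t) + (\#\{\text{odd caps}\} - \#\{\text{even cups}\})(g_t - f_s) \in A .$$ Then $\mathrm{JW}$ is homogeneous of degree $0$: it is a linear combination of TL diagrams of degree $0$. Moreover, every TL diagram with nonzero coefficient in $\mathrm{JW}$ has as many even caps as odd cups, and as many odd caps as even cups. -/

import Mathlib

/-- The position of an endpoint on the boundary circle of the planar strip with `n` endpoints on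
the top (`Sum.inl`) and `n` endpoints on the bottom (`Sum.inr`), each numbered from left to right:
the top row is read from left to right, then the bottom row from right to left. -/
def boundaryPos (n : ℕ) : Fin n ⊕ Fin n → ℕ
  | Sum.inl i => i
  | Sum.inr i => 2 * n - 1 - i

/-- A Temperley–Lieb diagram on `n` strands: a crossingless perfect matching of the `n` top and
the `n` bottom endpoints of the planar strip, given by the map sending an endpoint to the endpoint
it is joined to. -/
@[ext]
structure TLDiagram (n : ℕ) where
  partner : Fin n ⊕ Fin n → Fin n ⊕ Fin n
  partner_partner : ∀ x, partner (partner x) = x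
  partner_ne : ∀ x, partner x ≠ x
  noncrossing : ∀ x y, ¬ (boundaryPos n x < boundaryPos n y ∧
    boundaryPos n y < boundaryPos n (partner x) ∧
    boundaryPos n (partner x) < boundaryPos n (partner y))

namespace TLDiagram

variable {n : ℕ}

theorem partner_injective :
    Function.Injective (partner : TLDiagram n → Fin n ⊕ Fin n → Fin n ⊕ Fin n) :=
  fun _ _ h => TLDiagram.ext h

noncomputable instance : Fintype (TLDiagram n) := Fintype.ofInjective _ partner_injective

noncomputable instance : DecidableEq (TLDiagram n) := Classical.decEq _

/-- The identity diagram: `n` vertical strands. -/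
def identity (n : ℕ) : TLDiagram n where
  partner := Sum.swap
  partner_partner := Sum.swap_swap
  partner_ne := by rintro (x | x) <;> simp
  noncrossing := by
    rintro (⟨x, hx⟩ | ⟨x, hx⟩) (⟨y, hy⟩ | ⟨y, hy⟩) <;> simp [boundaryPos] <;> omega

/-- The underlying map of the elementary diagram on one row of endpoints. -/
def elementaryIndex (i : ℕ) (hi : i + 1 < n) (j : Fin n) : Fin n :=
  if (j : ℕ) = i then ⟨i + 1, hi⟩ else if (j : ℕ) = i + 1 then ⟨i, by omega⟩ else j

/-- The elementary diagram `U` at the neighbouring positions `i`, `i + 1` (counted from `0`):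
a cup joining these positions on top, a cap joining them on the bottom, and vertical strands
everywhere else. -/
def elementary (i : ℕ) (hi : i + 1 < n) : TLDiagram n where
  partner
    | Sum.inl j => if (j : ℕ) = i ∨ (j : ℕ) = i + 1 then Sum.inl (elementaryIndex i hi j)
        else Sum.inr j
    | Sum.inr j => if (j : ℕ) = i ∨ (j : ℕ) = i + 1 then Sum.inr (elementaryIndex i hi j)
        else Sum.inl j
  partner_partner := by
    rintro (⟨x, hx⟩ | ⟨x, hx⟩) <;> simp only [elementaryIndex] <;> grind
  partner_ne := by
    rintro (⟨x, hx⟩ | ⟨x, hx⟩) <;> simp only [elementaryIndex] <;> grind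
  noncrossing := by
    rintro (⟨x, hx⟩ | ⟨x, hx⟩) (⟨y, hy⟩ | ⟨y, hy⟩) <;>
      simp only [elementaryIndex] <;> split_ifs <;> simp only [boundaryPos] <;> omega

/-- Vertices of the picture in which `D₁` is stacked on top of `D₂`: the top endpoints of `D₁`,
the middle endpoints (bottom of `D₁` glued to top of `D₂`), the bottom endpoints of `D₂`. -/
abbrev StackVertex (n : ℕ) := Fin n ⊕ Fin n ⊕ Fin n

/-- The endpoints of the upper diagram inside the stacked picture. -/
def upper : Fin n ⊕ Fin n → StackVertex n
  | Sum.inl i => Sum.inl i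
  | Sum.inr i => Sum.inr (Sum.inl i)

/-- The endpoints of the lower diagram inside the stacked picture. -/
def lower : Fin n ⊕ Fin n → StackVertex n
  | Sum.inl i => Sum.inr (Sum.inl i)
  | Sum.inr i => Sum.inr (Sum.inr i)

/-- The outer endpoints (top and bottom boundary) of the stacked picture. -/
def outer : Fin n ⊕ Fin n → StackVertex n
  | Sum.inl i => Sum.inl i
  | Sum.inr i => Sum.inr (Sum.inr i)

/-- The graph formed by all strands of `D₁` stacked on top of `D₂`. -/
def stack (D₁ D₂ : TLDiagram n) : SimpleGraph (StackVertex n) :=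
  SimpleGraph.fromRel fun u v =>
    (∃ x, u = upper x ∧ v = upper (D₁.partner x)) ∨ (∃ x, u = lower x ∧ v = lower (D₂.partner x))

/-- `D` is the diagram obtained by stacking `D₁` on top of `D₂` and deleting closed loops:
its strands connect the outer endpoints which are connected in the stacked picture. -/
def IsComposite (D₁ D₂ D : TLDiagram n) : Prop :=
  ∀ x, (stack D₁ D₂).Reachable (outer x) (outer (D.partner x))

/-- The number of closed loops in the stacked picture: the connected components which do not
reach the outer boundary. -/
noncomputable def loops (D₁ D₂ : TLDiagram n) : ℕ :=
  Nat.card {c : (stack D₁ D₂).ConnectedComponent //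
    ∀ x, (stack D₁ D₂).connectedComponentMk (outer x) ≠ c}

/-- The endpoint with index `i` (counted from `0`) on the bottom is the left end of a cap. -/
def IsCap (D : TLDiagram n) (i : Fin n) : Prop := ∃ j, i < j ∧ D.partner (Sum.inr i) = Sum.inr j

/-- The endpoint with index `i` (counted from `0`) on the top is the left end of a cup. -/
def IsCup (D : TLDiagram n) (i : Fin n) : Prop := ∃ j, i < j ∧ D.partner (Sum.inl i) = Sum.inl j

open Classical in
/-- The (left ends of the) caps of a diagram. -/
noncomputable def caps (D : TLDiagram n) : Finset (Fin n) := {i | D.IsCap i}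

open Classical in
/-- The (left ends of the) cups of a diagram. -/
noncomputable def cups (D : TLDiagram n) : Finset (Fin n) := {i | D.IsCup i}

/-- The number of even caps: the left end has even index, where indices are `1, …, n`. -/
noncomputable def numEvenCaps (D : TLDiagram n) : ℕ := (D.caps.filter fun i => Even (i.val + 1)).card

/-- The number of odd caps: the left end has odd index, where indices are `1, …, n`. -/
noncomputable def numOddCaps (D : TLDiagram n) : ℕ := (D.caps.filter fun i => Odd (i.val + 1)).card

/-- The number of even cups: the left end has even index, where indices are `1, …, n`. -/
noncomputable def numEvenCups (D : TLDiagram n) : ℕ := (D.cups.filter fun i => Even (i.val + 1)).card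

/-- The number of odd cups: the left end has odd index, where indices are `1, …, n`. -/
noncomputable def numOddCups (D : TLDiagram n) : ℕ := (D.cups.filter fun i => Odd (i.val + 1)).card

end TLDiagram

/-- The Temperley–Lieb algebra on `n` strands with loop value `δ`: formal linear combinations of
diagrams, the value at a diagram being its coefficient. -/
def TemperleyLieb (k : Type*) [CommRing k] (n : ℕ) (_δ : k) : Type _ := TLDiagram n → k

namespace TemperleyLieb

variable {k : Type*} [CommRing k] {n : ℕ} {δ : k}

instance : AddCommGroup (TemperleyLieb k n δ) := inferInstanceAs (AddCommGroup (TLDiagram n → k))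

instance : Module k (TemperleyLieb k n δ) := inferInstanceAs (Module k (TLDiagram n → k))

/-- The coefficient of a diagram. -/
def coeff (X : TemperleyLieb k n δ) (D : TLDiagram n) : k := X D

/-- A diagram as an element of the Temperley–Lieb algebra. -/
noncomputable def ofDiagram (D : TLDiagram n) : TemperleyLieb k n δ :=
  (Pi.single D 1 : TLDiagram n → k)

open Classical in
/-- Multiplication: the bilinear extension of stacking of diagrams (left factor on top), where each
closed loop is replaced by the scalar `δ`. -/
noncomputable instance : Mul (TemperleyLieb k n δ) where
  mul X Y := fun D => ∑ D₁ : TLDiagram n, ∑ D₂ : TLDiagram n,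
    if TLDiagram.IsComposite D₁ D₂ D then δ ^ TLDiagram.loops D₁ D₂ * (X.coeff D₁ * Y.coeff D₂)
    else 0

/-- `J` is the Jones–Wenzl projector: the identity diagram has coefficient `1`, and `J` is killed
by all elementary cup-cap diagrams from above and from below. -/
structure IsJonesWenzl (J : TemperleyLieb k n δ) : Prop where
  coeff_identity : J.coeff (TLDiagram.identity n) = 1
  elementary_mul : ∀ (i : ℕ) (hi : i + 1 < n), ofDiagram (TLDiagram.elementary i hi) * J = 0
  mul_elementary : ∀ (i : ℕ) (hi : i + 1 < n), J * ofDiagram (TLDiagram.elementary i hi) = 0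

end TemperleyLieb

/-- The two colors. -/
inductive StrandColor
  | s
  | t

/-- The univalent and trivalent vertices of two-colored diagrams (read from bottom to top). -/
inductive HeckeVertex
  | startdot
  | enddot
  | split
  | merge

/-- The degree of a vertex of a given color, where startdots have degree `f` and enddots `g`. -/
def HeckeVertex.degree {A : Type*} [AddCommGroup A] (f g : StrandColor → A) (c : StrandColor) :
    HeckeVertex → A
  | startdot => f c
  | enddot => g c
  | split => -g c
  | merge => -f c

/-- The color of the region meeting the (top or bottom) boundary between the `j`-th and the
`(j+1)`-st endpoint, endpoints being counted from `1`. The colors alternate, and the leftmost region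
`j = 0` has color `s`. -/
def regionColor (j : ℕ) : StrandColor := if Even j then StrandColor.s else StrandColor.t

namespace TLDiagram

variable {n : ℕ} {A : Type*} [AddCommGroup A] (f g : StrandColor → A)

/-- The degree of a cap whose left end is the endpoint number `j + 1` (from the left): after
deformation retract of the colored regions it becomes an enddot in the color of the region below the
cap, under a merge in the color of the region above the cap. -/
def capDegree (j : ℕ) : A :=
  HeckeVertex.enddot.degree f g (regionColor (j + 1)) + HeckeVertex.merge.degree f g (regionColor j)

/-- The degree of a cup whose left end is the endpoint number `j + 1` (from the left): after
deformation retract of the colored regions it becomes a startdot in the color of the region above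
the cup, over a split in the color of the region below the cup. -/
def cupDegree (j : ℕ) : A :=
  HeckeVertex.startdot.degree f g (regionColor (j + 1)) +
    HeckeVertex.split.degree f g (regionColor j)

/-- The degree of a Temperley–Lieb diagram: the total degree of the vertices of its deformation
retract, to which each cup and each cap contributes one univalent and one trivalent vertex. -/
noncomputable def degree (D : TLDiagram n) : A :=
  ∑ i ∈ D.caps, capDegree f g i + ∑ i ∈ D.cups, cupDegree f g i

end TLDiagram

/-- The homogeneous elements of degree `a` of the Temperley–Lieb algebra: the span of the diagrams of
degree `a`. -/
noncomputable def TemperleyLieb.homogeneousPart {k : Type*} [CommRing k] {n : ℕ} {δ : k}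
    {A : Type*} [AddCommGroup A] (f g : StrandColor → A) (a : A) :
    Submodule k (TemperleyLieb k n δ) :=
  Submodule.span k {X | ∃ D : TLDiagram n, D.degree f g = a ∧ X = TemperleyLieb.ofDiagram D}

/-! For a parity q, let `numParity` count the strands whose first endpoint, in the order of the
boundary circle, has a position of parity q. Stacking U_i on top of a diagram D either closes a
loop, which gives 0 because the loop value is 0, or joins the neighbouring top points i, i + 1 and
their former partners. In the second case `numParity` changes by an amount depending on i and q but
not on D (`numParity_rewire`). It therefore behaves like a grading for left multiplication by the
U_i.

Keep from JW only the diagrams with the `numParity` of the identity. This truncation is still killed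
by every U_i from above, and its coefficient at the identity is still 1. Such an element must be JW:
if X is killed from below, Y from above, and both have coefficient 1 at the identity, then XY = Y
and XY = X (`eq_of_killed`). This rests on the fact that a diagram other than the identity has a cap
joining neighbours i, i + 1, so its composite with D depends on D only through U_i D
(`sum_composesTo_eq_zero`).

Finally, `card_caps_sub_card_cups` shows that up to a constant `numParity` is the number of caps of
one parity minus the number of cups of the other. Both vanish for the identity, hence the difference
vanishes throughout the support of JW. -/

namespace TLDiagram

variable {n : ℕ}

/-! ### Noncrossing matchings and rewiring -/

theorem boundaryPos_injective (n : ℕ) : Function.Injective (boundaryPos n) := by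
  rintro (⟨x, hx⟩ | ⟨x, hx⟩) (⟨y, hy⟩ | ⟨y, hy⟩) h <;> simp [boundaryPos] at h ⊢ <;> omega

theorem boundaryPos_lt (x : Fin n ⊕ Fin n) : boundaryPos n x < 2 * n := by
  rcases x with ⟨x, hx⟩ | ⟨x, hx⟩ <;> simp [boundaryPos] <;> omega

theorem boundaryPos_swap (x : Fin n ⊕ Fin n) :
    boundaryPos n x.swap = 2 * n - 1 - boundaryPos n x := by
  rcases x with ⟨x, hx⟩ | ⟨x, hx⟩ <;> simp [boundaryPos]; omega

theorem boundaryPos_ne {x y : Fin n ⊕ Fin n} (h : x ≠ y) : boundaryPos n x ≠ boundaryPos n y :=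
  fun e => h (boundaryPos_injective n e)

theorem partner_eq_iff (D : TLDiagram n) {x y : Fin n ⊕ Fin n} :
    D.partner x = y ↔ x = D.partner y :=
  ⟨fun h => by rw [← h, D.partner_partner], fun h => by rw [h, D.partner_partner]⟩

theorem partner_inj (D : TLDiagram n) {x y : Fin n ⊕ Fin n} :
    D.partner x = D.partner y ↔ x = y := by
  rw [D.partner_eq_iff, D.partner_partner]

/-- The endpoints of a strand lie on the same side of every other strand. -/
theorem lt_iff_lt_partner (D : TLDiagram n) {x z : Fin n ⊕ Fin n} (h₁ : z ≠ x)
    (h₂ : z ≠ D.partner x) :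
    (boundaryPos n x < boundaryPos n z ↔ boundaryPos n x < boundaryPos n (D.partner z)) ↔
      (boundaryPos n (D.partner x) < boundaryPos n z ↔
        boundaryPos n (D.partner x) < boundaryPos n (D.partner z)) := by
  have h := D.noncrossing
  have e := D.partner_partner
  have n₁ := boundaryPos_ne h₁
  have n₂ := boundaryPos_ne h₂
  have n₃ := boundaryPos_ne fun h => h₁ (D.partner_inj.1 h)
  have n₄ := boundaryPos_ne fun h => h₂ (D.partner_eq_iff.1 h)
  have a₁ := h x z
  have a₂ := h z x
  have a₃ := h x (D.partner z)
  have a₄ := h (D.partner z) x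
  have a₅ := h (D.partner x) z
  have a₆ := h z (D.partner x)
  have a₇ := h (D.partner x) (D.partner z)
  have a₈ := h (D.partner z) (D.partner x)
  simp only [e] at a₃ a₄ a₅ a₆ a₇ a₈
  clear h e
  rcases lt_or_gt_of_ne n₁ with n₁ | n₁ <;> rcases lt_or_gt_of_ne n₂ with n₂ | n₂ <;>
    rcases lt_or_gt_of_ne n₃ with n₃ | n₃ <;> rcases lt_or_gt_of_ne n₄ with n₄ | n₄ <;>
    simp only [n₁, n₂, n₃, n₄, n₁.not_gt, n₂.not_gt, n₃.not_gt, n₄.not_gt, iff_true,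
      iff_false, not_true] <;>
    omega

/-- The involution obtained from `D` by joining `a` to `b` and the partner of `a` to the partner of
`b`. -/
def rewirePartner (D : TLDiagram n) (a b z : Fin n ⊕ Fin n) : Fin n ⊕ Fin n :=
  if z = a then b else if z = b then a else if z = D.partner a then D.partner b
    else if z = D.partner b then D.partner a else D.partner z

/-- The diagram obtained from `D` by joining the neighbouring endpoints `a` and `b`, and joining
their former partners. -/
def rewire (D : TLDiagram n) (a b : Fin n ⊕ Fin n) (hab : boundaryPos n b = boundaryPos n a + 1)
    (h : D.partner a ≠ b) : TLDiagram n where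
  partner := D.rewirePartner a b
  partner_partner z := by
    have hne : a ≠ b := by rintro rfl; omega
    have e := D.partner_partner
    have e' := D.partner_ne
    simp only [rewirePartner]
    grind
  partner_ne z := by
    have hne : a ≠ b := by rintro rfl; omega
    have e := D.partner_partner
    have e' := D.partner_ne
    simp only [rewirePartner]
    grind
  noncrossing z w := by
    have hne : a ≠ b := by rintro rfl; omega
    have e := D.partner_partner
    have h' : D.partner b ≠ a := fun h' => h (by rw [← h', e])
    -- The strand of `z` survives from `D`. It cannot separate the neighbours `a` and `b`, hence not
    -- their partners either, so the new strands do not cross it. Both orders are stated because the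
    -- surviving strand may be either of the two compared.
    have key : ∀ z w, z ≠ a → z ≠ b → z ≠ D.partner a → z ≠ D.partner b →
        ¬ (boundaryPos n z < boundaryPos n w ∧
          boundaryPos n w < boundaryPos n (D.partner z) ∧
          boundaryPos n (D.partner z) < boundaryPos n (D.rewirePartner a b w)) ∧
        ¬ (boundaryPos n w < boundaryPos n z ∧
          boundaryPos n z < boundaryPos n (D.rewirePartner a b w) ∧
          boundaryPos n (D.rewirePartner a b w) < boundaryPos n (D.partner z)) := by
      intro z w h1 h2 h3 h4
      have h5 : D.partner z ≠ a := fun h => h3 (by rw [← h, e])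
      have h6 : D.partner z ≠ b := fun h => h4 (by rw [← h, e])
      have h7 := boundaryPos_ne h1
      have h8 := boundaryPos_ne h2
      have h9 := boundaryPos_ne h5
      have h10 := boundaryPos_ne h6
      have h11 := D.lt_iff_lt_partner h1 h3
      have h12 := D.lt_iff_lt_partner h2 h4
      simp only [rewirePartner]
      split_ifs with k1 k2 k3 k4
      · subst k1; omega
      · subst k2; omega
      · subst k3; omega
      · subst k4; omega
      · exact ⟨D.noncrossing z w, D.noncrossing w z⟩
    by_cases hz : z = a ∨ z = b ∨ z = D.partner a ∨ z = D.partner b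
    · by_cases hw : w = a ∨ w = b ∨ w = D.partner a ∨ w = D.partner b
      · have h1 := boundaryPos_ne (D.partner_ne a)
        have h2 := boundaryPos_ne (D.partner_ne b)
        have h3 := boundaryPos_ne h
        have h4 := boundaryPos_ne h'
        have h5 := boundaryPos_ne hne
        have f1 : D.partner a ≠ a := D.partner_ne a
        have f2 : D.partner b ≠ b := D.partner_ne b
        have f3 : D.partner a ≠ D.partner b := fun h => hne (D.partner_inj.1 h)
        rcases hz with rfl | rfl | rfl | rfl <;> rcases hw with rfl | rfl | rfl | rfl <;>
          simp only [rewirePartner, hne, hne.symm, f1, f2, f3, f3.symm, h, h', if_true, if_false]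
            <;> omega
      · push Not at hw
        have := (key w z hw.1 hw.2.1 hw.2.2.1 hw.2.2.2).2
        have e1 : D.rewirePartner a b w = D.partner w := by
          simp [rewirePartner, hw]
        rwa [e1]
    · push Not at hz
      have := (key z w hz.1 hz.2.1 hz.2.2.1 hz.2.2.2).1
      have e1 : D.rewirePartner a b z = D.partner z := by
        simp [rewirePartner, hz]
      rwa [e1]

/-! ### Parities of first endpoints -/

theorem even_card_of_involution {α : Type*} [DecidableEq α] (s : Finset α) (σ : α → α)
    (hs : ∀ x ∈ s, σ x ∈ s) (hσ : ∀ x ∈ s, σ (σ x) = x) (hne : ∀ x ∈ s, σ x ≠ x) :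
    Even s.card := by
  have : (∑ _x ∈ s, (1 : ZMod 2)) = 0 :=
    Finset.sum_involution (fun x _ => σ x) (fun _ _ => by decide) (fun x hx _ => hne x hx)
      (fun x hx => hs x hx) (fun x hx => hσ x hx)
  rw [Finset.sum_const, nsmul_one] at this
  exact (ZMod.natCast_eq_zero_iff_even).1 this

theorem card_boundaryPos_Ioo (P Q : ℕ) (hQ : Q ≤ 2 * n) :
    (Finset.univ.filter fun x : Fin n ⊕ Fin n => P < boundaryPos n x ∧ boundaryPos n x < Q).card =
      Q - P - 1 := by
  rw [← Nat.card_Ioo]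
  refine Finset.card_bij (fun x _ => boundaryPos n x) (by simp)
    (fun _ _ _ _ h => boundaryPos_injective n h) fun q hq => ?_
  rw [Finset.mem_Ioo] at hq
  by_cases h : q < n
  · exact ⟨Sum.inl ⟨q, h⟩, Finset.mem_filter.2 ⟨Finset.mem_univ _, hq⟩, by simp [boundaryPos]⟩
  · have : 2 * n - 1 - (2 * n - 1 - q) = q := by omega
    exact ⟨Sum.inr ⟨2 * n - 1 - q, by omega⟩, Finset.mem_filter.2
      ⟨Finset.mem_univ _, by simpa [boundaryPos, this] using hq⟩,
      by simp [boundaryPos, this]⟩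

/-- The endpoints strictly between a point and its partner are matched among themselves, so their
number is even. -/
theorem odd_boundaryPos_add_partner (D : TLDiagram n) (x : Fin n ⊕ Fin n) :
    Odd (boundaryPos n x + boundaryPos n (D.partner x)) := by
  wlog hlt : boundaryPos n x < boundaryPos n (D.partner x) generalizing x with H
  · have := boundaryPos_ne (D.partner_ne x)
    have h := H (D.partner x) (by rw [D.partner_partner]; omega)
    rwa [D.partner_partner, add_comm] at h
  have h := even_card_of_involution (Finset.univ.filter fun y : Fin n ⊕ Fin n =>
    boundaryPos n x < boundaryPos n y ∧ boundaryPos n y < boundaryPos n (D.partner x)) D.partner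
    (fun y hy => by
      have h1 := D.noncrossing x y
      have h1' := D.noncrossing (D.partner y) x
      rw [D.partner_partner] at h1'
      simp only [Finset.mem_filter_univ] at hy ⊢
      have h2 : D.partner y ≠ x := fun h => by rw [← h, D.partner_partner] at hy; omega
      have h3 : D.partner y ≠ D.partner x := fun h => by rw [D.partner_inj.1 h] at hy; omega
      have := boundaryPos_ne h2
      have := boundaryPos_ne h3
      omega)
    (fun y _ => D.partner_partner y) (fun y _ => D.partner_ne y)
  rw [card_boundaryPos_Ioo _ _ (boundaryPos_lt _).le] at h
  grind

/-- The number of strands whose first endpoint on the boundary circle has parity `q`. -/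
def numParity (D : TLDiagram n) (q : ℕ) : ℤ :=
  ∑ x, if boundaryPos n x < boundaryPos n (D.partner x) ∧ boundaryPos n x % 2 = q then 1 else 0

/-- Let A, B = A + 1, X, Y be the positions of `a`, `b` and their partners. Strands join opposite
parities, so X has the parity of B and Y that of A. By noncrossing, either Y lies between B and X,
or X < A and B < Y, or Y < X < A. In each case the new first endpoints are the old ones with one
parity of B replaced by a parity of A. -/
theorem numParity_rewire (D : TLDiagram n) (q : ℕ) (a b : Fin n ⊕ Fin n)
    (hab : boundaryPos n b = boundaryPos n a + 1) (h : D.partner a ≠ b) :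
    (D.rewire a b hab h).numParity q = D.numParity q +
      ((if boundaryPos n a % 2 = q then 1 else 0) - if boundaryPos n b % 2 = q then 1 else 0) := by
  have hne : a ≠ b := by rintro rfl; omega
  have e := D.partner_partner
  have h' : D.partner b ≠ a := fun h' => h (by rw [← h', e])
  have f1 : D.partner a ≠ a := D.partner_ne a
  have f2 : D.partner b ≠ b := D.partner_ne b
  have f3 : D.partner a ≠ D.partner b := fun h => hne (D.partner_inj.1 h)
  rw [← sub_eq_iff_eq_add', numParity, numParity, ← Finset.sum_sub_distrib,
    ← Finset.sum_subset (Finset.subset_univ {a, b, D.partner a, D.partner b})]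
  · rw [Finset.sum_insert (by simp [hne, f1.symm, h'.symm]),
      Finset.sum_insert (by simp [h.symm, f2.symm]), Finset.sum_pair f3]
    simp only [rewire, rewirePartner, hne, hne.symm, f1, f2, f3, f3.symm, h, h', if_true, if_false,
      e]
    have h1 := boundaryPos_ne f1
    have h2 := boundaryPos_ne f2
    have h3 := boundaryPos_ne h
    have h4 := boundaryPos_ne h'
    have h5 := boundaryPos_ne f3
    have h6 := D.lt_iff_lt_partner (x := a) (z := b) hne.symm h.symm
    have h7 := Nat.odd_iff.1 (D.odd_boundaryPos_add_partner a)
    have h8 := Nat.odd_iff.1 (D.odd_boundaryPos_add_partner b)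
    generalize boundaryPos n a = A at *
    generalize boundaryPos n b = B at *
    generalize boundaryPos n (D.partner a) = X at *
    generalize boundaryPos n (D.partner b) = Y at *
    subst hab
    clear e f1 f2 f3 h h' hne
    have h0 := Nat.lt_succ_self A
    rcases lt_or_gt_of_ne h1 with h1 | h1 <;> rcases lt_or_gt_of_ne h2 with h2 | h2 <;>
      rcases lt_or_gt_of_ne h5 with h5 | h5 <;>
      simp only [h0, h0.not_gt, h1, h2, h5, h1.not_gt, h2.not_gt, h5.not_gt,
        true_and, false_and, if_false] <;>
      clear h0 <;> split_ifs <;> omega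
  · intro z _ hz
    simp only [Finset.mem_insert, Finset.mem_singleton, not_or] at hz
    simp [rewire, rewirePartner, hz]

/-! ### Connectivity in stacked diagrams -/

theorem reachable_upper (D₁ D₂ : TLDiagram n) (x : Fin n ⊕ Fin n) :
    (stack D₁ D₂).Reachable (upper x) (upper (D₁.partner x)) := by
  by_cases h : upper x = upper (D₁.partner x)
  · rw [h]
  · exact (SimpleGraph.Adj.reachable
      ((SimpleGraph.fromRel_adj _ _ _).2 ⟨h, Or.inl (Or.inl ⟨x, rfl, rfl⟩)⟩))

theorem reachable_lower (D₁ D₂ : TLDiagram n) (x : Fin n ⊕ Fin n) :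
    (stack D₁ D₂).Reachable (lower x) (lower (D₂.partner x)) := by
  by_cases h : lower x = lower (D₂.partner x)
  · rw [h]
  · exact (SimpleGraph.Adj.reachable
      ((SimpleGraph.fromRel_adj _ _ _).2 ⟨h, Or.inl (Or.inr ⟨x, rfl, rfl⟩)⟩))

/-- Reachability in the stacked picture is the least equivalence relation which relates the ends of
each strand. -/
theorem reachable_le {D₁ D₂ : TLDiagram n} {r : StackVertex n → StackVertex n → Prop}
    (hr : Equivalence r) (h₁ : ∀ x, r (upper x) (upper (D₁.partner x)))
    (h₂ : ∀ x, r (lower x) (lower (D₂.partner x))) {u v : StackVertex n}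
    (h : (stack D₁ D₂).Reachable u v) : r u v := by
  obtain ⟨w⟩ := h
  induction w with
  | nil => exact hr.refl _
  | cons hadj _ ih =>
    refine hr.trans ?_ ih
    rcases ((SimpleGraph.fromRel_adj _ _ _).1 hadj).2 with
      (⟨x, rfl, rfl⟩ | ⟨x, rfl, rfl⟩) | (⟨x, rfl, rfl⟩ | ⟨x, rfl, rfl⟩)
    exacts [h₁ x, h₂ x, hr.symm (h₁ x), hr.symm (h₂ x)]

theorem equivalence_reachable_comp {V W : Type*} (G : SimpleGraph W) (φ : V → W) :
    Equivalence fun u v => G.Reachable (φ u) (φ v) :=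
  ⟨fun _ => .refl _, fun h => h.symm, fun h h' => h.trans h'⟩

/-- Stacking `D₁` on top of `D₂` gives `E`, without closed loops. -/
def ComposesTo (D₁ D₂ E : TLDiagram n) : Prop :=
  IsComposite D₁ D₂ E ∧ ∀ v, ∃ x, (stack D₁ D₂).Reachable (outer x) v

theorem loops_eq_zero_iff (D₁ D₂ : TLDiagram n) :
    loops D₁ D₂ = 0 ↔ ∀ v, ∃ x, (stack D₁ D₂).Reachable (outer x) v := by
  rw [loops, Finite.card_eq_zero_iff, isEmpty_subtype]
  refine ⟨fun h v => ?_, fun h c => ?_⟩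
  · have := h ((stack D₁ D₂).connectedComponentMk v)
    push Not at this
    obtain ⟨x, hx⟩ := this
    exact ⟨x, SimpleGraph.ConnectedComponent.eq.1 hx⟩
  · induction c using SimpleGraph.ConnectedComponent.ind with | _ v
    obtain ⟨x, hx⟩ := h v
    exact fun h => h x (SimpleGraph.ConnectedComponent.eq.2 hx)

theorem lower_injective : Function.Injective (lower : Fin n ⊕ Fin n → StackVertex n) := by
  rintro (x | x) (y | y) h <;> simp_all [lower]

/-- A strand of the lower diagram which ends under the `i`-th and `j`-th bottom endpoints of the
upper diagram, joined to each other, may be pulled through. -/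
theorem reachable_rewire {D₁ D₂ F : TLDiagram n} {i j : Fin n}
    (h₁ : D₁.partner (Sum.inr i) = Sum.inr j) (h₂ : D₂.partner (Sum.inl i) ≠ Sum.inl j)
    (hF : F.partner = D₂.rewirePartner (Sum.inl i) (Sum.inl j)) {u v : StackVertex n}
    (hu : u ≠ lower (Sum.inl i) ∧ u ≠ lower (Sum.inl j))
    (hv : v ≠ lower (Sum.inl i) ∧ v ≠ lower (Sum.inl j)) :
    (stack D₁ D₂).Reachable u v ↔ (stack D₁ F).Reachable u v := by
  have hij : Sum.inl i ≠ (Sum.inl j : Fin n ⊕ Fin n) := by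
    rintro h
    rw [Sum.inl_injective h] at h₁
    exact D₁.partner_ne _ h₁
  have h₂' : D₂.partner (Sum.inl j) ≠ Sum.inl i := fun h => h₂ (D₂.partner_eq_iff.1 h).symm
  have e₁ : D₂.partner (Sum.inl i) ≠ Sum.inl i := D₂.partner_ne _
  have e₂ : D₂.partner (Sum.inl j) ≠ Sum.inl j := D₂.partner_ne _
  have hF' : (stack D₁ F).Reachable (lower (D₂.partner (Sum.inl i)))
      (lower (D₂.partner (Sum.inl j))) := by
    have := reachable_lower D₁ F (D₂.partner (Sum.inl i))
    rw [hF] at this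
    simpa [rewirePartner, h₂, e₁] using this
  -- Slides the two middle points under the cap along their strands in `D₂` to the far ends, which
  -- `F` joins directly. All other vertices stay fixed.
  let φ : StackVertex n → StackVertex n := fun v =>
    if v = lower (Sum.inl i) then lower (D₂.partner (Sum.inl i))
    else if v = lower (Sum.inl j) then lower (D₂.partner (Sum.inl j)) else v
  have hφ : ∀ v, v ≠ lower (Sum.inl i) → v ≠ lower (Sum.inl j) → φ v = v := fun v h h' => by
    simp only [φ, if_neg h, if_neg h']
  have hi : φ (lower (Sum.inl i)) = lower (D₂.partner (Sum.inl i)) := if_pos rfl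
  have hj : φ (lower (Sum.inl j)) = lower (D₂.partner (Sum.inl j)) := by
    simp only [φ, if_neg (lower_injective.ne hij.symm), if_true]
  have hu₁ : ∀ x : Fin n ⊕ Fin n, x ≠ Sum.inr i → x ≠ Sum.inr j → φ (upper x) = upper x :=
    fun x h h' => hφ _ (by rcases x with x | x <;> simp_all [upper, lower])
      (by rcases x with x | x <;> simp_all [upper, lower])
  have hl₁ : ∀ x : Fin n ⊕ Fin n, x ≠ Sum.inl i → x ≠ Sum.inl j → φ (lower x) = lower x :=
    fun x h h' => hφ _ (lower_injective.ne h) (lower_injective.ne h')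
  constructor
  · intro h
    rw [← hφ u hu.1 hu.2, ← hφ v hv.1 hv.2]
    refine reachable_le (equivalence_reachable_comp _ φ) (fun x => ?_) (fun x => ?_) h
    · by_cases hx : x = Sum.inr i
      · subst hx
        rw [h₁]
        exact (hi.symm ▸ hj.symm ▸ hF' :
          (stack D₁ F).Reachable (φ (lower (Sum.inl i))) (φ (lower (Sum.inl j))))
      by_cases hx' : x = Sum.inr j
      · subst hx'
        rw [← D₁.partner_eq_iff.1 h₁]
        exact (hi.symm ▸ hj.symm ▸ hF'.symm :
          (stack D₁ F).Reachable (φ (lower (Sum.inl j))) (φ (lower (Sum.inl i))))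
      rw [hu₁ x hx hx', hu₁ _ (fun h => hx' (by rw [← h₁, ← h, D₁.partner_partner]))
        (fun h => hx (by rw [D₁.partner_eq_iff.1 h₁, ← h, D₁.partner_partner]))]
      exact reachable_upper _ _ _
    · by_cases hx : x = Sum.inl i
      · subst hx
        rw [hi, hl₁ _ e₁ h₂]
      by_cases hx' : x = Sum.inl j
      · subst hx'
        rw [hj, hl₁ _ h₂' e₂]
      by_cases hy : D₂.partner x = Sum.inl i
      · rw [hy, hi, hl₁ x hx hx', D₂.partner_eq_iff.1 hy]
      by_cases hy' : D₂.partner x = Sum.inl j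
      · rw [hy', hj, hl₁ x hx hx', D₂.partner_eq_iff.1 hy']
      rw [hl₁ x hx hx', hl₁ _ hy hy']
      have := reachable_lower D₁ F x
      rwa [hF, rewirePartner, if_neg hx, if_neg hx', if_neg fun h => hy (D₂.partner_eq_iff.2 h),
        if_neg fun h => hy' (D₂.partner_eq_iff.2 h)] at this
  · intro h
    have hij' : (stack D₁ D₂).Reachable (lower (Sum.inl i)) (lower (Sum.inl j)) := by
      have := reachable_upper D₁ D₂ (Sum.inr i)
      rwa [h₁] at this
    have hab : (stack D₁ D₂).Reachable (lower (D₂.partner (Sum.inl i)))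
        (lower (D₂.partner (Sum.inl j))) :=
      ((reachable_lower _ _ _).symm.trans hij').trans (reachable_lower _ _ _)
    refine reachable_le (equivalence_reachable_comp _ id) (reachable_upper _ _) (fun x => ?_) h
    rw [hF, rewirePartner]
    split_ifs with k₁ k₂ k₃ k₄
    · rw [k₁]; exact hij'
    · rw [k₂]; exact hij'.symm
    · rw [k₃]; exact hab
    · rw [k₄]; exact hab.symm
    · exact reachable_lower _ _ _

theorem outer_ne_lower_inl (x : Fin n ⊕ Fin n) (i : Fin n) : outer x ≠ lower (Sum.inl i) := by
  rcases x with x | x <;> simp [outer, lower]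

/-- The right side involves `D₂` only through its rewiring `F`. In `F` the points `i` and `j` close
a loop with the cap of `D₁`, so they are exempt from having to reach the boundary. -/
theorem composesTo_iff_rewire {D₁ D₂ E F : TLDiagram n} {i j : Fin n}
    (h₁ : D₁.partner (Sum.inr i) = Sum.inr j) (h₂ : D₂.partner (Sum.inl i) ≠ Sum.inl j)
    (hF : F.partner = D₂.rewirePartner (Sum.inl i) (Sum.inl j)) :
    ComposesTo D₁ D₂ E ↔ IsComposite D₁ F E ∧
      ∀ v, v ≠ lower (Sum.inl i) → v ≠ lower (Sum.inl j) →
        ∃ x, (stack D₁ F).Reachable (outer x) v := by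
  have ho : ∀ x : Fin n ⊕ Fin n, outer x ≠ lower (Sum.inl i) ∧ outer x ≠ lower (Sum.inl j) :=
    fun x => ⟨outer_ne_lower_inl _ _, outer_ne_lower_inl _ _⟩
  refine and_congr (forall_congr' fun x => reachable_rewire h₁ h₂ hF (ho _) (ho _))
    ⟨fun h v hi hj => ?_, fun h v => ?_⟩
  · obtain ⟨x, hx⟩ := h v
    exact ⟨x, (reachable_rewire h₁ h₂ hF (ho _) ⟨hi, hj⟩).1 hx⟩
  · have hij : Sum.inl i ≠ (Sum.inl j : Fin n ⊕ Fin n) := by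
      rintro h
      rw [Sum.inl_injective h] at h₁
      exact D₁.partner_ne _ h₁
    have h₂' : D₂.partner (Sum.inl j) ≠ Sum.inl i := fun h => h₂ (D₂.partner_eq_iff.1 h).symm
    have key : ∀ v, v ≠ lower (Sum.inl i) → v ≠ lower (Sum.inl j) →
        ∃ x, (stack D₁ D₂).Reachable (outer x) v := fun v hi hj => by
      obtain ⟨x, hx⟩ := h v hi hj
      exact ⟨x, (reachable_rewire h₁ h₂ hF (ho _) ⟨hi, hj⟩).2 hx⟩
    by_cases hi : v = lower (Sum.inl i)
    · obtain ⟨x, hx⟩ := key (lower (D₂.partner (Sum.inl i)))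
        (lower_injective.ne (D₂.partner_ne _)) (lower_injective.ne h₂)
      exact ⟨x, hi ▸ hx.trans (reachable_lower _ _ _).symm⟩
    by_cases hj : v = lower (Sum.inl j)
    · obtain ⟨x, hx⟩ := key (lower (D₂.partner (Sum.inl j)))
        (lower_injective.ne h₂') (lower_injective.ne (D₂.partner_ne _))
      exact ⟨x, hj ▸ hx.trans (reachable_lower _ _ _).symm⟩
    exact key v hi hj

/-! ### Composites with the identity and with elementary diagrams -/

/-- The projection of the stacked picture which contracts the upper diagram vertically. -/
def contractUpper : StackVertex n → Fin n ⊕ Fin n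
  | Sum.inl k => Sum.inl k
  | Sum.inr (Sum.inl k) => Sum.inl k
  | Sum.inr (Sum.inr k) => Sum.inr k

theorem contractUpper_outer (x : Fin n ⊕ Fin n) : contractUpper (outer x) = x := by
  rcases x with x | x <;> rfl

theorem contractUpper_lower (x : Fin n ⊕ Fin n) : contractUpper (lower x) = x := by
  rcases x with x | x <;> rfl

/-- If contracting the upper diagram maps its strands to points or to strands of the lower diagram,
then the composite is the lower diagram. -/
theorem IsComposite.eq_of_contractUpper {D₁ F E : TLDiagram n} (h : IsComposite D₁ F E)
    (h₁ : ∀ x, contractUpper (upper x) = contractUpper (upper (D₁.partner x)) ∨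
      contractUpper (upper x) = F.partner (contractUpper (upper (D₁.partner x)))) : E = F := by
  have hr : Equivalence fun u v : StackVertex n =>
      contractUpper u = contractUpper v ∨ contractUpper u = F.partner (contractUpper v) := by
    refine ⟨fun _ => Or.inl rfl, fun h => ?_, fun h h' => ?_⟩
    · rcases h with h | h
      · exact Or.inl h.symm
      · exact Or.inr (F.partner_eq_iff.1 h.symm)
    · rcases h with h | h <;> rcases h' with h' | h' <;> rw [h, h'] <;> simp [F.partner_partner]
  ext1
  funext x
  have := reachable_le hr h₁
    (fun x => Or.inr (by rw [contractUpper_lower, contractUpper_lower, F.partner_partner])) (h x)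
  rw [contractUpper_outer, contractUpper_outer] at this
  rcases this with h | h
  · exact absurd h.symm (E.partner_ne x)
  · rw [F.partner_eq_iff.1 h.symm]

theorem composesTo_identity_left {D E : TLDiagram n} : ComposesTo (identity n) D E ↔ D = E := by
  have key : ∀ x, (stack (identity n) D).Reachable (outer x) (lower x) := by
    rintro (x | x)
    · exact reachable_upper (identity n) D (Sum.inl x)
    · exact .refl _
  constructor
  · refine fun h => (h.1.eq_of_contractUpper ?_).symm
    rintro (x | x) <;> exact Or.inl rfl
  · rintro rfl
    refine ⟨fun x => ((key x).trans (reachable_lower _ _ x)).trans (key _).symm, ?_⟩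
    rintro (x | x | x)
    exacts [⟨Sum.inl x, .refl _⟩, ⟨Sum.inl x, key _⟩, ⟨Sum.inr x, .refl _⟩]

theorem elementary_partner_inr (i : ℕ) (hi : i + 1 < n) :
    (elementary i hi).partner (Sum.inr ⟨i, by omega⟩) = Sum.inr ⟨i + 1, hi⟩ := by
  simp [elementary, elementaryIndex]

theorem elementary_partner_inl (i : ℕ) (hi : i + 1 < n) :
    (elementary i hi).partner (Sum.inl ⟨i, by omega⟩) = Sum.inl ⟨i + 1, hi⟩ := by
  simp [elementary, elementaryIndex]

/-- A cap meeting a cup forms a closed loop. -/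
theorem ComposesTo.partner_inl_ne {D₁ D₂ E : TLDiagram n} (h : ComposesTo D₁ D₂ E) {i j : Fin n}
    (h₁ : D₁.partner (Sum.inr i) = Sum.inr j) : D₂.partner (Sum.inl i) ≠ Sum.inl j := by
  intro h₂
  have h₁' := D₁.partner_eq_iff.1 h₁
  have h₂' := D₂.partner_eq_iff.1 h₂
  -- The two middle points form a closed loop: membership in this pair is constant along every
  -- strand, and no outer point belongs to it.
  let r : StackVertex n → StackVertex n → Prop := fun u v =>
    (u = lower (Sum.inl i) ∨ u = lower (Sum.inl j)) ↔
      (v = lower (Sum.inl i) ∨ v = lower (Sum.inl j))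
  have hu : ∀ (x : Fin n ⊕ Fin n) (k : Fin n), upper x = lower (Sum.inl k) ↔ x = Sum.inr k := by
    rintro (x | x) k <;> simp [upper, lower]
  obtain ⟨x, hx⟩ := h.2 (lower (Sum.inl i))
  have key : r (outer x) (lower (Sum.inl i)) := by
    refine reachable_le ⟨fun _ => Iff.rfl, fun h => h.symm, fun h h' => h.trans h'⟩
      (fun x => ?_) (fun x => ?_) hx
    · simp only [r, hu, D₁.partner_eq_iff, ← h₁', h₁]
      exact or_comm
    · simp only [r, lower_injective.eq_iff, D₂.partner_eq_iff, ← h₂', h₂]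
      exact or_comm
  exact absurd (key.2 (Or.inl rfl)) (by simp [outer_ne_lower_inl])

theorem composesTo_elementary_iff {i : ℕ} {hi : i + 1 < n} {D E : TLDiagram n} :
    ComposesTo (elementary i hi) D E ↔
      ∃ h : D.partner (Sum.inl ⟨i, by omega⟩) ≠ Sum.inl ⟨i + 1, hi⟩,
        D.rewire (Sum.inl ⟨i, by omega⟩) (Sum.inl ⟨i + 1, hi⟩) rfl h = E := by
  have hne : (Sum.inl ⟨i, by omega⟩ : Fin n ⊕ Fin n) ≠ Sum.inl ⟨i + 1, hi⟩ := by simp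
  by_cases h : D.partner (Sum.inl ⟨i, by omega⟩) = Sum.inl ⟨i + 1, hi⟩
  · refine iff_of_false (fun hE => hE.partner_inl_ne (elementary_partner_inr i hi) h)
      (fun hE => hE.1 h)
  · rw [exists_prop_of_true h, composesTo_iff_rewire (elementary_partner_inr i hi) h
      (F := D.rewire _ _ rfl h) rfl]
    have hF : (D.rewire (Sum.inl ⟨i, by omega⟩) (Sum.inl ⟨i + 1, hi⟩) rfl h).partner
        (Sum.inl ⟨i, by omega⟩) = Sum.inl ⟨i + 1, hi⟩ := by simp [rewire, rewirePartner]
    generalize D.rewire (Sum.inl ⟨i, by omega⟩) (Sum.inl ⟨i + 1, hi⟩) rfl h = F at hF ⊢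
    have hF' := (F.partner_eq_iff.1 hF).symm
    constructor
    · rintro ⟨hE, -⟩
      refine (hE.eq_of_contractUpper ?_).symm
      rintro (⟨x, hx⟩ | ⟨x, hx⟩) <;> simp only [elementary, elementaryIndex] <;>
        split_ifs <;> simp_all [upper, contractUpper]
    · rintro rfl
      have key : ∀ x, x ≠ Sum.inl ⟨i, by omega⟩ → x ≠ Sum.inl ⟨i + 1, hi⟩ →
          (stack (elementary i hi) F).Reachable (outer x) (lower x) := by
        rintro (x | x) h h'
        · have := reachable_upper (elementary i hi) F (Sum.inl x)
          have h₁ : ¬ ((x : ℕ) = i ∨ (x : ℕ) = i + 1) := by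
            rintro (e | e)
            · exact h (congrArg Sum.inl (Fin.ext e))
            · exact h' (congrArg Sum.inl (Fin.ext e))
          simp only [elementary, if_neg h₁] at this
          exact this
        · exact .refl _
      have hU : (stack (elementary i hi) F).Reachable (outer (Sum.inl ⟨i, by omega⟩))
          (outer (Sum.inl ⟨i + 1, hi⟩)) := by
        have := reachable_upper (elementary i hi) F (Sum.inl ⟨i, by omega⟩)
        rwa [elementary_partner_inl] at this
      refine ⟨fun x => ?_, ?_⟩
      · by_cases hx : x = Sum.inl ⟨i, by omega⟩
        · rw [hx, hF]; exact hU
        by_cases hx' : x = Sum.inl ⟨i + 1, hi⟩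
        · rw [hx', hF']; exact hU.symm
        exact ((key x hx hx').trans (reachable_lower _ _ x)).trans
          (key _ (fun h => hx' (by rw [← hF, ← h, F.partner_partner]))
            (fun h => hx (by rw [← hF', ← h, F.partner_partner]))).symm
      · rintro (x | x | x) h h'
        · exact ⟨Sum.inl x, .refl _⟩
        · exact ⟨Sum.inl x, key _ (fun e => h (congrArg lower e)) (fun e => h' (congrArg lower e))⟩
        · exact ⟨Sum.inr x, .refl _⟩

/-! ### Reflection and innermost caps -/

/-- The reflection of a diagram in a horizontal line. -/
def flip (D : TLDiagram n) : TLDiagram n where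
  partner x := (D.partner x.swap).swap
  partner_partner x := by simp [D.partner_partner]
  partner_ne x h := D.partner_ne x.swap (Sum.swap_leftInverse.injective (by rw [h, Sum.swap_swap]))
  noncrossing x y h := by
    simp only [boundaryPos_swap] at h
    have h₁ := boundaryPos_swap x
    have h₂ := boundaryPos_swap y
    have := boundaryPos_lt x
    have := boundaryPos_lt y
    have := boundaryPos_lt (D.partner x.swap)
    have := boundaryPos_lt (D.partner y.swap)
    -- Reflection reverses the circular order, so a crossing is read backwards, starting from the
    -- partners.
    have := D.noncrossing (D.partner y.swap) (D.partner x.swap)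
    simp only [D.partner_partner] at this
    omega

theorem flip_flip (D : TLDiagram n) : D.flip.flip = D := by
  ext1
  funext x
  simp [flip]

theorem flip_identity : (identity n).flip = identity n := by
  ext1
  funext x
  simp [flip, identity]

theorem flip_elementary (i : ℕ) (hi : i + 1 < n) : (elementary i hi).flip = elementary i hi := by
  ext1
  funext x
  rcases x with x | x <;> simp only [flip, elementary, Sum.swap_inl, Sum.swap_inr] <;> split_ifs <;>
    rfl

theorem ComposesTo.flip {D₁ D₂ E : TLDiagram n} (h : ComposesTo D₁ D₂ E) :
    ComposesTo D₂.flip D₁.flip E.flip := by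
  let φ : StackVertex n → StackVertex n
    | Sum.inl k => Sum.inr (Sum.inr k)
    | Sum.inr (Sum.inl k) => Sum.inr (Sum.inl k)
    | Sum.inr (Sum.inr k) => Sum.inl k
  have hu : ∀ x, φ (upper x) = lower x.swap := by rintro (x | x) <;> rfl
  have hl : ∀ x, φ (lower x) = upper x.swap := by rintro (x | x) <;> rfl
  have ho : ∀ x, φ (outer x) = outer x.swap := by rintro (x | x) <;> rfl
  have hφ : ∀ v, φ (φ v) = v := by rintro (x | x | x) <;> rfl
  have key : ∀ u v, (stack D₁ D₂).Reachable u v →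
      (stack D₂.flip D₁.flip).Reachable (φ u) (φ v) := fun u v huv => by
    refine reachable_le (equivalence_reachable_comp _ φ) (fun x => ?_) (fun x => ?_) huv
    · rw [hu, hu]
      simpa [TLDiagram.flip] using reachable_lower D₂.flip D₁.flip x.swap
    · rw [hl, hl]
      simpa [TLDiagram.flip] using reachable_upper D₂.flip D₁.flip x.swap
  refine ⟨fun x => ?_, fun v => ?_⟩
  · simpa [ho, TLDiagram.flip] using key _ _ (h.1 x.swap)
  · obtain ⟨x, hx⟩ := h.2 (φ v)
    exact ⟨x.swap, by simpa [ho, hφ] using key _ _ hx⟩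

theorem composesTo_flip_iff {D₁ D₂ E : TLDiagram n} :
    ComposesTo D₂.flip D₁.flip E.flip ↔ ComposesTo D₁ D₂ E :=
  ⟨fun h => by simpa only [flip_flip] using h.flip, ComposesTo.flip⟩

theorem composesTo_identity_right {D E : TLDiagram n} : ComposesTo D (identity n) E ↔ D = E := by
  rw [← composesTo_flip_iff, flip_identity, composesTo_identity_left]
  exact ⟨fun h => by rw [← D.flip_flip, h, flip_flip], fun h => h ▸ rfl⟩

/-- A diagram other than the identity has a cap joining neighbouring endpoints. -/
theorem exists_partner_inr_of_ne_identity {D : TLDiagram n} (h : D ≠ identity n) :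
    ∃ (i : ℕ) (hi : i + 1 < n), D.partner (Sum.inr ⟨i, by omega⟩) = Sum.inr ⟨i + 1, hi⟩ := by
  by_cases hc : ∃ i j : Fin n, i < j ∧ D.partner (Sum.inr i) = Sum.inr j
  · obtain ⟨i, j, hij, hD⟩ := hc
    induction hd : (j : ℕ) - i using Nat.strong_induction_on generalizing i j with
    | _ d ih =>
      obtain ⟨i, hi⟩ := i
      obtain ⟨j, hj⟩ := j
      simp only [Fin.mk_lt_mk] at hij hd
      rcases eq_or_ne j (i + 1) with rfl | hne
      · exact ⟨i, hj, hD⟩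
      -- The point next to the left end of a cap is matched inside that cap, which yields a shorter
      -- cap.
      have hp := D.lt_iff_lt_partner (x := Sum.inr ⟨i, hi⟩) (z := Sum.inr ⟨i + 1, by omega⟩)
        (by simp) (by rw [hD]; simpa using hne.symm)
      have h₁ := boundaryPos_ne (D.partner_ne (Sum.inr ⟨i + 1, by omega⟩))
      have h₂ : D.partner (Sum.inr ⟨i + 1, by omega⟩) ≠ Sum.inr ⟨i, hi⟩ := fun h => by
        rw [D.partner_eq_iff, hD] at h
        simp at h
        omega
      have h₃ : D.partner (Sum.inr ⟨i + 1, by omega⟩) ≠ Sum.inr ⟨j, hj⟩ := fun h => by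
        rw [← hD, D.partner_inj] at h
        simp at h
      rw [hD] at hp
      rcases hl : D.partner (Sum.inr ⟨i + 1, by omega⟩) with ⟨l, hl'⟩ | ⟨l, hl'⟩ <;>
        rw [hl] at hp h₁ h₂ h₃ <;> simp only [boundaryPos, ne_eq, Sum.inr.injEq, Fin.mk.injEq] at *
      · omega
      · exact ih (l - (i + 1)) (by omega) ⟨i + 1, by omega⟩ ⟨l, hl'⟩ (by simp; omega) hl rfl
  · refine absurd ?_ h
    have hσ : ∀ i : Fin n, ∃ j : Fin n, D.partner (Sum.inr i) = Sum.inl j := fun i => by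
      rcases hi : D.partner (Sum.inr i) with j | j
      · exact ⟨j, rfl⟩
      · refine absurd ?_ hc
        rcases lt_trichotomy i j with hij | rfl | hij
        · exact ⟨i, j, hij, hi⟩
        · exact absurd hi (D.partner_ne _)
        · exact ⟨j, i, hij, (D.partner_eq_iff.1 hi).symm⟩
    choose σ hσ using hσ
    have hinj : Function.Injective σ := fun i j hij =>
      Sum.inr_injective (D.partner_inj.1 (by rw [hσ, hσ, hij]))
    have hmono : StrictMono σ := fun i j hij => by
      by_contra hlt
      have hlt := lt_of_le_of_ne (not_lt.1 hlt) (hinj.ne hij.ne')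
      have := D.noncrossing (Sum.inl (σ j)) (Sum.inl (σ i))
      rw [← hσ, ← hσ, D.partner_partner, D.partner_partner, hσ, hσ] at this
      simp only [boundaryPos, Fin.lt_def] at *
      omega
    have hid : σ = id := (StrictMono.range_inj hmono strictMono_id).1
      (by rw [(Finite.injective_iff_surjective.1 hinj).range_eq, Set.range_id])
    ext1
    funext x
    rcases x with x | x
    · have := hσ x
      rw [hid, id, D.partner_eq_iff] at this
      rw [← this]
      rfl
    · rw [hσ, hid]
      rfl

end TLDiagram

/-! ### Uniqueness and the truncation argument -/

namespace TLDiagram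

variable {n : ℕ} {k : Type*} [CommRing k]

open Classical in
/-- If all elementary diagrams kill `Y` from above, then so do all diagrams but the identity. -/
theorem sum_composesTo_eq_zero {Y : TLDiagram n → k}
    (hY : ∀ (i : ℕ) (hi : i + 1 < n) (F : TLDiagram n),
      ∑ D, (if ComposesTo (elementary i hi) D F then Y D else 0) = 0)
    {D₁ : TLDiagram n} (h : D₁ ≠ identity n) (E : TLDiagram n) :
    ∑ D, (if ComposesTo D₁ D E then Y D else 0) = 0 := by
  obtain ⟨i, hi, hD₁⟩ := exists_partner_inr_of_ne_identity h
  -- The composite of the elementary diagram with `D`. The default value `D` is harmless, since by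
  -- `hcup` it does not occur when `D₁` and `D` compose to `E`.
  let ρ : TLDiagram n → TLDiagram n := fun D =>
    if h : D.partner (Sum.inl ⟨i, by omega⟩) ≠ Sum.inl ⟨i + 1, hi⟩ then
      D.rewire (Sum.inl ⟨i, by omega⟩) (Sum.inl ⟨i + 1, hi⟩) rfl h else D
  have hcup : ∀ D, ComposesTo D₁ D E →
      D.partner (Sum.inl ⟨i, by omega⟩) ≠ Sum.inl ⟨i + 1, hi⟩ := fun D h => h.partner_inl_ne hD₁
  have hρ : ∀ D D', ComposesTo D₁ D E →
      (ComposesTo (elementary i hi) D' (ρ D) ↔ ComposesTo D₁ D' E ∧ ρ D' = ρ D) := by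
    intro D D' hD
    rw [composesTo_elementary_iff]
    constructor
    · rintro ⟨h', hF⟩
      refine ⟨?_, by simp only [← hF, ρ, dif_pos h']⟩
      simp only [ρ, dif_pos (hcup D hD)] at hF
      rw [composesTo_iff_rewire hD₁ h' rfl (F := D'.rewire _ _ rfl h'), hF,
        ← composesTo_iff_rewire hD₁ (hcup D hD) rfl]
      exact hD
    · rintro ⟨h', hF⟩
      refine ⟨hcup D' h', ?_⟩
      rw [← hF]
      simp only [ρ, dif_pos (hcup D' h')]
  -- By `hρ`, each nonempty fibre of `ρ` over F consists of all diagrams that the elementary diagram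
  -- sends to F, so `hY` makes its sum vanish.
  rw [← Finset.sum_filter, ← Finset.sum_fiberwise _ ρ]
  refine Finset.sum_eq_zero fun F _ => ?_
  by_cases hF : ∃ D, ComposesTo D₁ D E ∧ ρ D = F
  · obtain ⟨D, hD, rfl⟩ := hF
    rw [← hY i hi (ρ D), ← Finset.sum_filter, Finset.filter_filter]
    exact Finset.sum_congr (Finset.filter_congr fun D' _ => (hρ D D' hD).symm) fun _ _ => rfl
  · rw [Finset.filter_eq_empty_iff.2, Finset.sum_empty]
    intro D hD hDF
    exact hF ⟨D, (Finset.mem_filter.1 hD).2, hDF⟩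

open Classical in
/-- A combination of diagrams which is killed from both sides is determined by its coefficient at
the identity. -/
theorem eq_of_killed {X Y : TLDiagram n → k}
    (hX : ∀ (i : ℕ) (hi : i + 1 < n) (F : TLDiagram n),
      ∑ D, (if ComposesTo D (elementary i hi) F then X D else 0) = 0)
    (hY : ∀ (i : ℕ) (hi : i + 1 < n) (F : TLDiagram n),
      ∑ D, (if ComposesTo (elementary i hi) D F then Y D else 0) = 0)
    (hX₁ : X (identity n) = 1) (hY₁ : Y (identity n) = 1) : X = Y := by
  funext E
  have flip_sum : ∀ (D₂ F : TLDiagram n),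
      ∑ D, (if ComposesTo D D₂ F then X D else 0) =
        ∑ D, (if ComposesTo D₂.flip D F.flip then X D.flip else 0) := fun D₂ F =>
    Finset.sum_bij' (fun D _ => D.flip) (fun D _ => D.flip) (by simp) (by simp)
      (by simp [flip_flip]) (by simp [flip_flip]) (by simp [composesTo_flip_iff, flip_flip])
  have hX' : ∀ D₂ ≠ identity n, ∑ D₁, (if ComposesTo D₁ D₂ E then X D₁ else 0) = 0 := by
    intro D₂ h
    rw [flip_sum]
    refine sum_composesTo_eq_zero (Y := fun D => X D.flip) (fun i hi F => ?_) (fun h' => h ?_) _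
    · have := hX i hi F.flip
      rwa [flip_sum, flip_elementary, flip_flip] at this
    · rw [← flip_flip D₂, h', flip_identity]
  -- The coefficient of `E` in the product XY: summing over `D₂` first leaves Y, summing over `D₁`
  -- first leaves X.
  have h₁ : ∑ D₁, ∑ D₂, (if ComposesTo D₁ D₂ E then X D₁ * Y D₂ else 0) = Y E := by
    rw [Finset.sum_eq_single (identity n)]
    · simp [composesTo_identity_left, hX₁]
    · intro D₁ _ h
      have := congrArg (X D₁ * ·) (sum_composesTo_eq_zero hY h E)
      simpa [Finset.mul_sum] using this
    · simp
  have h₂ : ∑ D₁, ∑ D₂, (if ComposesTo D₁ D₂ E then X D₁ * Y D₂ else 0) = X E := by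
    rw [Finset.sum_comm, Finset.sum_eq_single (identity n)]
    · simp [composesTo_identity_right, hY₁]
    · intro D₂ _ h
      have := congrArg (· * Y D₂) (hX' D₂ h)
      simpa [Finset.sum_mul] using this
    · simp
  rw [← h₂, h₁]

open Classical in
theorem numParity_eq_of_killed {X : TLDiagram n → k}
    (hX : ∀ (i : ℕ) (hi : i + 1 < n) (F : TLDiagram n),
      ∑ D, (if ComposesTo D (elementary i hi) F then X D else 0) = 0)
    (hX' : ∀ (i : ℕ) (hi : i + 1 < n) (F : TLDiagram n),
      ∑ D, (if ComposesTo (elementary i hi) D F then X D else 0) = 0)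
    (hX₁ : X (identity n) = 1) (q : ℕ) {D : TLDiagram n} (hD : X D ≠ 0) :
    D.numParity q = (identity n).numParity q := by
  let Y : TLDiagram n → k := fun D =>
    if D.numParity q = (identity n).numParity q then X D else 0
  have hXY : X = Y := by
    refine eq_of_killed hX (fun i hi F => ?_) hX₁ (by simp [Y, hX₁])
    have hF : ∀ D, ComposesTo (elementary i hi) D F → F.numParity q = D.numParity q +
        ((if i % 2 = q then 1 else 0) - if (i + 1) % 2 = q then 1 else 0) := by
      intro D hD
      obtain ⟨h, rfl⟩ := composesTo_elementary_iff.1 hD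
      exact D.numParity_rewire q _ _ rfl h
    -- All diagrams sent to `F` have the same `numParity`, so the truncation keeps either all terms
    -- of the sum or none.
    by_cases h : F.numParity q = (identity n).numParity q +
        ((if i % 2 = q then 1 else 0) - if (i + 1) % 2 = q then 1 else 0)
    · refine (Finset.sum_congr rfl fun D _ => ?_).trans (hX' i hi F)
      split_ifs with hD
      · exact if_pos (add_right_cancel ((hF D hD).symm.trans h))
      · rfl
    · refine Finset.sum_eq_zero fun D _ => ?_
      split_ifs with hD
      · exact if_neg fun h' => h (by rw [hF D hD, h'])
      · rfl
  by_contra h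
  exact hD (by rw [hXY]; exact if_neg h)

end TLDiagram

/-! ### Transfer to the Temperley–Lieb algebra -/

namespace TemperleyLieb

variable {n : ℕ} {k : Type*} [CommRing k]

open Classical TLDiagram

theorem mul_apply_zero (X Y : TemperleyLieb k n 0) (F : TLDiagram n) :
    (X * Y).coeff F = ∑ D₁, ∑ D₂, if ComposesTo D₁ D₂ F then X.coeff D₁ * Y.coeff D₂ else 0 := by
  refine Finset.sum_congr rfl fun D₁ _ => Finset.sum_congr rfl fun D₂ _ => ?_
  rw [ComposesTo, ← loops_eq_zero_iff]
  by_cases h : loops D₁ D₂ = 0 <;> simp [h]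

theorem ofDiagram_coeff (D E : TLDiagram n) :
    (ofDiagram D : TemperleyLieb k n 0).coeff E = if E = D then 1 else 0 := by
  simp [ofDiagram, coeff, Pi.single_apply]

theorem ofDiagram_mul_coeff (D : TLDiagram n) (Y : TemperleyLieb k n 0) (F : TLDiagram n) :
    (ofDiagram D * Y).coeff F = ∑ D₂, if ComposesTo D D₂ F then Y.coeff D₂ else 0 := by
  rw [mul_apply_zero, Finset.sum_eq_single D]
  · simp [ofDiagram_coeff]
  · intro D' _ h
    simp [ofDiagram_coeff, h]
  · simp

theorem mul_ofDiagram_coeff (D : TLDiagram n) (X : TemperleyLieb k n 0) (F : TLDiagram n) :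
    (X * ofDiagram D).coeff F = ∑ D₁, if ComposesTo D₁ D F then X.coeff D₁ else 0 := by
  rw [mul_apply_zero, Finset.sum_comm, Finset.sum_eq_single D]
  · simp [ofDiagram_coeff]
  · intro D' _ h
    simp [ofDiagram_coeff, h]
  · simp

theorem IsJonesWenzl.numParity_eq {J : TemperleyLieb k n 0} (hJ : J.IsJonesWenzl) (q : ℕ)
    {D : TLDiagram n} (hD : J.coeff D ≠ 0) : D.numParity q = (identity n).numParity q := by
  refine numParity_eq_of_killed (X := J.coeff) (fun i hi F => ?_) (fun i hi F => ?_)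
    hJ.coeff_identity q hD
  · rw [← mul_ofDiagram_coeff, hJ.mul_elementary]; rfl
  · rw [← ofDiagram_mul_coeff, hJ.elementary_mul]; rfl

theorem mem_homogeneousPart {A : Type*} [AddCommGroup A] (f g : StrandColor → A) (a : A)
    (X : TemperleyLieb k n 0) (h : ∀ D, X.coeff D ≠ 0 → D.degree f g = a) :
    X ∈ homogeneousPart f g a := by
  have hX : X = ∑ D, X.coeff D • (ofDiagram D : TemperleyLieb k n 0) := by
    refine (pi_eq_sum_univ' (ι := TLDiagram n) (R := k) X).trans
      (Finset.sum_congr rfl fun D _ => ?_)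
    refine congrArg (X.coeff D • ·) ?_
    funext E
    simp [ofDiagram, Pi.single_apply, eq_comm]
  rw [hX]
  refine Submodule.sum_mem _ fun D _ => ?_
  by_cases hD : X.coeff D = 0
  · rw [hD, zero_smul]
    exact Submodule.zero_mem _
  · exact Submodule.smul_mem _ _ (Submodule.subset_span ⟨D, h D hD, rfl⟩)

end TemperleyLieb

/-! ### Counting caps and cups by parity -/

namespace TLDiagram

variable {n : ℕ}

theorem degree_eq {A : Type*} [AddCommGroup A] (f g : StrandColor → A) (D : TLDiagram n) :
    D.degree f g = ((D.numEvenCaps : ℤ) - D.numOddCups) • (g .s - f .t) +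
      ((D.numOddCaps : ℤ) - D.numEvenCups) • (g .t - f .s) := by
  have hcap : ∑ i ∈ D.caps, capDegree f g i =
      D.numEvenCaps • (g .s - f .t) + D.numOddCaps • (g .t - f .s) := by
    rw [← Finset.sum_filter_add_sum_filter_not _ fun i : Fin n => Even (i.val + 1)]
    simp only [Nat.not_even_iff_odd]
    congr 1
    · refine Finset.sum_eq_card_nsmul fun i hi => ?_
      have h := (Finset.mem_filter.1 hi).2
      have h' : ¬ Even (i : ℕ) := Nat.even_add_one.1 h
      simp [capDegree, regionColor, h, h', HeckeVertex.degree, sub_eq_add_neg]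
    · refine Finset.sum_eq_card_nsmul fun i hi => ?_
      have h := Nat.not_even_iff_odd.2 (Finset.mem_filter.1 hi).2
      have h' : Even (i : ℕ) := by rwa [Nat.even_add_one, not_not] at h
      simp [capDegree, regionColor, h, h', HeckeVertex.degree, sub_eq_add_neg]
  have hcup : ∑ i ∈ D.cups, cupDegree f g i =
      D.numEvenCups • (f .s - g .t) + D.numOddCups • (f .t - g .s) := by
    rw [← Finset.sum_filter_add_sum_filter_not _ fun i : Fin n => Even (i.val + 1)]
    simp only [Nat.not_even_iff_odd]
    congr 1
    · refine Finset.sum_eq_card_nsmul fun i hi => ?_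
      have h := (Finset.mem_filter.1 hi).2
      have h' : ¬ Even (i : ℕ) := Nat.even_add_one.1 h
      simp [cupDegree, regionColor, h, h', HeckeVertex.degree, sub_eq_add_neg]
    · refine Finset.sum_eq_card_nsmul fun i hi => ?_
      have h := Nat.not_even_iff_odd.2 (Finset.mem_filter.1 hi).2
      have h' : Even (i : ℕ) := by rwa [Nat.even_add_one, not_not] at h
      simp [cupDegree, regionColor, h, h', HeckeVertex.degree, sub_eq_add_neg]
  rw [degree, hcap, hcup]
  simp only [← natCast_zsmul]
  module

open Classical in
/-- On each row, right ends of arcs are in bijection with left ends, of the other parity. -/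
theorem card_right_ends (D : TLDiagram n) {s : Fin n → Fin n ⊕ Fin n} (hs : Function.Injective s)
    (hpar : ∀ i j : Fin n, D.partner (s i) = s j → (i : ℕ) % 2 ≠ (j : ℕ) % 2) {q : ℕ} (hq : q < 2) :
    (Finset.univ.filter fun i : Fin n =>
      (∃ j, j < i ∧ D.partner (s i) = s j) ∧ (i : ℕ) % 2 = 1 - q).card =
    (Finset.univ.filter fun i : Fin n =>
      (∃ j, i < j ∧ D.partner (s i) = s j) ∧ (i : ℕ) % 2 = q).card := by
  rw [← Finset.card_image_of_injective _ hs, ← Finset.card_image_of_injective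
    (Finset.univ.filter fun i : Fin n => (∃ j, i < j ∧ D.partner (s i) = s j) ∧ (i : ℕ) % 2 = q)
    (f := fun i => D.partner (s i)) fun i j h => hs (D.partner_inj.1 h)]
  congr 1
  ext x
  simp only [Finset.mem_image, Finset.mem_filter_univ]
  constructor
  · rintro ⟨i, ⟨⟨j, hji, hij⟩, hi⟩, rfl⟩
    have := hpar i j hij
    have hij' := (D.partner_eq_iff.1 hij).symm
    exact ⟨j, ⟨⟨i, hji, hij'⟩, by omega⟩, hij'⟩
  · rintro ⟨i, ⟨⟨j, hji, hij⟩, hi⟩, rfl⟩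
    have := hpar i j hij
    exact ⟨j, ⟨⟨i, hji, (D.partner_eq_iff.1 hij).symm⟩, by omega⟩, hij.symm⟩

open Classical in
/-- The number of caps minus the number of cups whose left ends have given parities, expressed by
the parities of the first endpoints of all strands. -/
theorem card_caps_sub_card_cups (D : TLDiagram n) (q : ℕ) (hq : q < 2) :
    ((D.caps.filter fun i => i.val % 2 = q).card : ℤ) -
      (D.cups.filter fun i => i.val % 2 = 1 - q).card =
        D.numParity q - (Finset.univ.filter fun i : Fin n => (i : ℕ) % 2 = q).card := by
  have hl : ∀ i j : Fin n, D.partner (Sum.inl i) = Sum.inl j → (i : ℕ) % 2 ≠ (j : ℕ) % 2 := by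
    intro i j hij
    have := D.odd_boundaryPos_add_partner (Sum.inl i)
    rw [hij, Nat.odd_iff] at this
    simp only [boundaryPos] at this
    omega
  have hr : ∀ i j : Fin n, D.partner (Sum.inr i) = Sum.inr j → (i : ℕ) % 2 ≠ (j : ℕ) % 2 := by
    intro i j hij
    have := D.odd_boundaryPos_add_partner (Sum.inr i)
    rw [hij, Nat.odd_iff] at this
    simp only [boundaryPos] at this
    omega
  -- The bottom row is read from right to left, so the first endpoint of a cap is its right end, and
  -- position and index have opposite parities there.
  have hcaps : (D.caps.filter fun i => i.val % 2 = q).card = (Finset.univ.filter fun i : Fin n =>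
      (∃ j, j < i ∧ D.partner (Sum.inr i) = Sum.inr j) ∧ (i : ℕ) % 2 = 1 - q).card := by
    rw [D.card_right_ends Sum.inr_injective hr hq, caps, Finset.filter_filter]
    congr
  have hcups : (D.cups.filter fun i => i.val % 2 = 1 - q).card =
      (Finset.univ.filter fun i : Fin n =>
        (∃ j, j < i ∧ D.partner (Sum.inl i) = Sum.inl j) ∧ (i : ℕ) % 2 = q).card := by
    have := D.card_right_ends Sum.inl_injective hl (q := 1 - q) (by omega)
    rw [show 1 - (1 - q) = q by omega] at this
    rw [this, cups, Finset.filter_filter]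
    congr
  rw [hcaps, hcups, numParity, Fintype.sum_sum_type, Finset.card_filter, Finset.card_filter,
    Finset.card_filter]
  push_cast
  have h₁ : ∀ i : Fin n, (if boundaryPos n (Sum.inr i) < boundaryPos n (D.partner (Sum.inr i)) ∧
      boundaryPos n (Sum.inr i) % 2 = q then (1 : ℤ) else 0) =
      if (∃ j, j < i ∧ D.partner (Sum.inr i) = Sum.inr j) ∧ (i : ℕ) % 2 = 1 - q then 1 else 0 := by
    intro i
    refine if_congr (and_congr ?_ ?_) rfl rfl
    · rcases D.partner (Sum.inr i) with j | j <;>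
        simp only [boundaryPos, reduceCtorEq, and_false, exists_false, iff_false,
          Sum.inr.injEq, exists_eq_right', Fin.lt_def] <;> omega
    · simp only [boundaryPos]
      omega
  -- Through strands and cups start on the top row, so a top point fails to be a first endpoint
  -- exactly when it is the right end of a cup.
  have h₂ : ∀ i : Fin n, (if boundaryPos n (Sum.inl i) < boundaryPos n (D.partner (Sum.inl i)) ∧
      boundaryPos n (Sum.inl i) % 2 = q then (1 : ℤ) else 0) = (if (i : ℕ) % 2 = q then 1 else 0) -
      if (∃ j, j < i ∧ D.partner (Sum.inl i) = Sum.inl j) ∧ (i : ℕ) % 2 = q then 1 else 0 := by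
    intro i
    have : boundaryPos n (Sum.inl i) < boundaryPos n (D.partner (Sum.inl i)) ↔
        ¬ ∃ j, j < i ∧ D.partner (Sum.inl i) = Sum.inl j := by
      have hne := D.partner_ne (Sum.inl i)
      revert hne
      rcases D.partner (Sum.inl i) with j | j <;> intro hne
      · have : (j : ℕ) ≠ i := fun h => hne (congrArg Sum.inl (Fin.ext h))
        simp only [boundaryPos, Sum.inl.injEq, exists_eq_right', Fin.lt_def]
        omega
      · simp only [boundaryPos, reduceCtorEq, and_false, exists_false, not_false_iff, iff_true]
        omega
    have hi : boundaryPos n (Sum.inl i) = i := rfl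
    simp only [this]
    rw [hi]
    by_cases hi : (i : ℕ) % 2 = q <;>
      by_cases hj : ∃ j, j < i ∧ D.partner (Sum.inl i) = Sum.inl j <;> simp only [hi, hj] <;> simp
  rw [Finset.sum_congr rfl fun i _ => h₁ i, Finset.sum_congr rfl fun i _ => h₂ i,
    Finset.sum_sub_distrib]
  ring

end TLDiagram

/-! ### The theorem -/

theorem proposition4 {k : Type*} [CommRing k] (p : ℕ) [Fact p.Prime] [CharP k p] (r m : ℕ)
    (hm : m = 2 * p ^ r) {A : Type*} [AddCommGroup A] (f g : StrandColor → A)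
    (JW : TemperleyLieb k (m - 1) 0) (hJW : JW.IsJonesWenzl) :
    JW ∈ TemperleyLieb.homogeneousPart f g 0 ∧
      ∀ D : TLDiagram (m - 1), JW.coeff D ≠ 0 →
        D.numEvenCaps = D.numOddCups ∧ D.numOddCaps = D.numEvenCups := by
  have key : ∀ D : TLDiagram (m - 1), JW.coeff D ≠ 0 →
      D.numEvenCaps = D.numOddCups ∧ D.numOddCaps = D.numEvenCups := fun D hD => by
    have h : ∀ q, q < 2 → (D.caps.filter fun i => i.val % 2 = q).card =
        (D.cups.filter fun i => i.val % 2 = 1 - q).card := fun q hq => by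
      have h₁ := D.card_caps_sub_card_cups q hq
      have h₂ := (TLDiagram.identity (m - 1)).card_caps_sub_card_cups q hq
      have h₃ : (TLDiagram.identity (m - 1)).caps = ∅ := by
        simp [TLDiagram.caps, TLDiagram.IsCap, TLDiagram.identity]
      have h₄ : (TLDiagram.identity (m - 1)).cups = ∅ := by
        simp [TLDiagram.cups, TLDiagram.IsCup, TLDiagram.identity]
      rw [h₃, h₄, ← hJW.numParity_eq q hD, ← h₁] at h₂
      simp only [Finset.filter_empty, Finset.card_empty] at h₂
      omega
    -- Endpoints are numbered from 1 in the statement but from 0 in `Fin`, so parities are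
    -- exchanged.
    have even_iff : ∀ i : ℕ, Even (i + 1) ↔ i % 2 = 1 := fun i => by grind
    have odd_iff : ∀ i : ℕ, Odd (i + 1) ↔ i % 2 = 0 := fun i => by grind
    simp only [TLDiagram.numEvenCaps, TLDiagram.numOddCups, TLDiagram.numOddCaps,
      TLDiagram.numEvenCups, even_iff, odd_iff]
    exact ⟨h 1 (by omega), h 0 (by omega)⟩
  refine ⟨TemperleyLieb.mem_homogeneousPart f g 0 JW fun D hD => ?_, key⟩
  obtain ⟨h₁, h₂⟩ := key D hD
  simp [D.degree_eq, h₁, h₂]
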